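/- Let $\hbar>0$, $\mathfrak H=L^2(\mathbf R^d;\mathbf C)$. A density operator is a bounded operator $R=R^*\ge 0$ on $\mathfrak H$ with $\operatorname{trace}R=1$. For a probability density $p$ on $\mathbf R^d\times\mathbf R^d$ and a density operator $R$, let $\mathcal C(p,R)$ be the set of weakly measurable functions $(x,\xi)\mapsto Q(x,\xi)\in\mathcal L(\mathfrak H)$ such that $Q(x,\xi)=Q(x,\xi)^*\ge 0$ and $\operatorname{trace}Q(x,\xi)=p(x,\xi)$ for a.e. $(x,\xi)$, and $\iint Q(x,\xi)\,dx\,d\xi=R$ (weak integral). For $\kappa>0$ put $$E^{(\kappa)}_\hbar(p,R)=\Big(\inf_{Q\in\mathcal C(p,R)}\iint \operatorname{trace}\big(Q(x,\xi)^{1/2}\,\kappa\,(|x-y|^2+|\xi+i\hbar\nabla_y|^2)\,Q(x,\xi)^{1/2}\big)\,dx\,d\xi\Big)^{1/2}\in[0,+\infty],$$ where $|x-y|^2+|\xi+i\hbar\nabla_y|^2$ is the nonnegative self-adjoint operator on $L^2(\mathbf R^d_y)$ defined by its quadratic form, and let $E_\hbar=E^{(1/2)}_\hbar$. Let $\operatorname{dist}_{MK,2}$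 be the Monge--Kantorovich (Wasserstein) distance of exponent $2$ on $\mathbf R^{2d}$, $\operatorname{dist}_{MK,2}(\mu,\nu)^2=\inf_\gamma\int|z-w|^2\,\gamma(dz\,dw)$ over the measures $\gamma$ with marginals $\mu$ and $\nu$. Let $f,g$ be probability densities on $\mathbf R^{2d}$ and let $R$ be a density operator on $\mathfrak H$ such that $$\int_{\mathbf R^{2d}}(|p|^2+|q|^2)(f(p,q)+g(p,q))\,dp\,dq<\infty\quad\text{and}\quad \operatorname{trace}\big(R^{1/2}(-\hbar^2\Delta+|x|^2)R^{1/2}\big)<\infty.$$ Then $$E_\hbar(f,R)\le \operatorname{dist}_{MK,2}(f,g)+E_\hbar(g,R),$$ and the same inequality holds for the cost without the factor $\tfrac12$: $$E^{(1)}_\hbar(f,R)\le \operatorname{dist}_{MK,2}(f,g)+E^{(1)}_\hbar(g,R).$$ -/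

import Mathlib

open MeasureTheory
open scoped ENNReal InnerProductSpace FourierTransform

noncomputable section

namespace SemiclassicalTransport

/-- Euclidean space `ℝ^d`. -/
abbrev Config (d : ℕ) : Type := EuclideanSpace ℝ (Fin d)

/-- Phase space `ℝ^d × ℝ^d`, with points `(x, ξ)` and Lebesgue measure `dx dξ`. Its Lean metric is
the sup metric of the product and is never used below: the Euclidean square distance is always
written out. -/
abbrev Phase (d : ℕ) : Type := Config d × Config d

/-- The Hilbert space `L²(ℝ^d; ℂ)`. -/
abbrev Hilb (d : ℕ) : Type := Lp ℂ 2 (volume : Measure (Config d))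

/-- Euclidean square distance `|x - y|² + |ξ - η|²` on phase space. -/
def sqDist {d : ℕ} (z w : Phase d) : ℝ := ‖z.1 - w.1‖ ^ 2 + ‖z.2 - w.2‖ ^ 2

/-- `f` is a probability density on phase space. -/
structure IsProbDensity {d : ℕ} (f : Phase d → ℝ) : Prop where
  nonneg : 0 ≤ᵐ[volume] f
  integrable : Integrable f volume
  integral_eq_one : ∫ z, f z = 1

/-- The measure `f(x, ξ) dx dξ`. -/
def densityMeasure {d : ℕ} (f : Phase d → ℝ) : Measure (Phase d) :=
  volume.withDensity fun z => ENNReal.ofReal (f z)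

/-- `γ` belongs to `Γ(μ, ν)`: its marginals are `μ` and `ν`. -/
def IsClassicalCoupling {d : ℕ} (μ ν : Measure (Phase d)) (γ : Measure (Phase d × Phase d)) :
    Prop :=
  γ.map Prod.fst = μ ∧ γ.map Prod.snd = ν

/-- The Monge–Kantorovich (Wasserstein) distance of exponent two. -/
def distMK2 {d : ℕ} (μ ν : Measure (Phase d)) : ℝ≥0∞ :=
  (⨅ (γ : Measure (Phase d × Phase d)) (_ : IsClassicalCoupling μ ν γ),
    ∫⁻ p, ENNReal.ofReal (sqDist p.1 p.2) ∂γ) ^ (1 / 2 : ℝ)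

section Trace

variable {H : Type*} [NormedAddCommGroup H] [InnerProductSpace ℂ H] [CompleteSpace H]

variable (H) in
/-- The index set of a fixed orthonormal basis of the Hilbert space `H`. -/
def basisIndex : Set H := (exists_hilbertBasis ℂ H).choose

variable (H) in
/-- A fixed orthonormal basis of `H`, used to write traces. Below these are traces of nonnegative
operators and of closed nonnegative quadratic forms, which do not depend on the basis. -/
def basis : HilbertBasis (basisIndex H) ℂ H := (exists_hilbertBasis ℂ H).choose_spec.choose

/-- The trace, in `[0, ∞]`, of a nonnegative bounded operator. -/
def trace (T : H →L[ℂ] H) : ℝ≥0∞ :=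
  ∑' i, ENNReal.ofReal (RCLike.re ⟪basis H i, T (basis H i)⟫_ℂ)

/-- `R` is a density operator: `R = R* ≥ 0` and `trace R = 1`. -/
structure IsDensityOperator (R : H →L[ℂ] H) : Prop where
  isPositive : R.IsPositive
  trace_eq_one : trace R = 1

/-- The nonnegative square root of a nonnegative bounded operator. -/
def opSqrt (T : H →L[ℂ] H) : H →L[ℂ] H := CFC.sqrt T

/-- `trace (C T) = trace (T^{1/2} C T^{1/2})`, in `[0, ∞]`, for a bounded operator `T ≥ 0` and a
nonnegative self-adjoint, possibly unbounded, operator `C` with quadratic form `q`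
(`q ψ = ⟨ψ, C ψ⟩`, with value `∞` outside of the form domain). -/
def formTrace (q : H → ℝ≥0∞) (T : H →L[ℂ] H) : ℝ≥0∞ := ∑' i, q (opSqrt T (basis H i))

end Trace

/-- The quadratic form, with values in `[0, ∞]` (and equal to `∞` exactly outside of the form
domain), of the nonnegative self-adjoint operator
`|x - y|² + |ξ + iħ∇_y|²` on `L²(ℝ^d_y)`, where `z = (x, ξ)`.
As `𝓕 ψ (k) = ∫ e^{-2πi k·y} ψ(y) dy`, the operator `ξ + iħ∇_y` is multiplication by `ξ - 2πħk`
in the Fourier variable `k`. -/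
def oscForm {d : ℕ} (ħ : ℝ) (z : Phase d) (ψ : Hilb d) : ℝ≥0∞ :=
  (∫⁻ y, ENNReal.ofReal (‖z.1 - y‖ ^ 2) * ‖ψ y‖ₑ ^ 2) +
    ∫⁻ k, ENNReal.ofReal (‖z.2 - (2 * Real.pi * ħ) • k‖ ^ 2) * ‖(𝓕 ψ : Hilb d) k‖ₑ ^ 2

/-- `trace (C Q)`, in `[0, ∞]`, for a bounded operator `Q ≥ 0` and
`C = |x - y|² + |ξ + iħ∇_y|²` at `z = (x, ξ)`. At `z = 0` the operator `C` is `-ħ²Δ + |y|²`. -/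
def oscTrace {d : ℕ} (ħ : ℝ) (z : Phase d) (Q : Hilb d →L[ℂ] Hilb d) : ℝ≥0∞ :=
  formTrace (oscForm ħ z) Q

/-- `Q` is a coupling of the probability density `p` and of the density operator `R`: a (weakly)
measurable function with values in the nonnegative trace-class operators such that
`trace Q(x, ξ) = p(x, ξ)` almost everywhere and `∬ Q(x, ξ) dx dξ = R` (in the weak sense). -/
structure IsCoupling {d : ℕ} (p : Phase d → ℝ) (R : Hilb d →L[ℂ] Hilb d)
    (Q : Phase d → Hilb d →L[ℂ] Hilb d) : Prop where
  aemeasurable : ∀ φ ψ : Hilb d, AEMeasurable (fun z => ⟪φ, Q z ψ⟫_ℂ) volume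
  isPositive : ∀ᵐ z : Phase d, (Q z).IsPositive
  trace_eq : ∀ᵐ z : Phase d, trace (Q z) = ENNReal.ofReal (p z)
  integral_eq : ∀ φ ψ : Hilb d,
    Integrable (fun z => ⟪φ, Q z ψ⟫_ℂ) volume ∧ ∫ z, ⟪φ, Q z ψ⟫_ℂ = ⟪φ, R ψ⟫_ℂ

/-- The pseudo-distance between `p` and `R` for the cost `κ (|x - y|² + |ξ + iħ∇_y|²)`. -/
def transportE {d : ℕ} (κ : ℝ≥0∞) (ħ : ℝ) (p : Phase d → ℝ) (R : Hilb d →L[ℂ] Hilb d) : ℝ≥0∞ :=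
  (⨅ (Q : Phase d → Hilb d →L[ℂ] Hilb d) (_ : IsCoupling p R Q),
    ∫⁻ z, κ * oscTrace ħ z (Q z)) ^ (1 / 2 : ℝ)

/-- `E_ħ(p, R)`, for the cost `c_ħ(x, ξ) = ½ (|x - y|² + |ξ + iħ∇_y|²)`. -/
def Ehbar {d : ℕ} (ħ : ℝ) (p : Phase d → ℝ) (R : Hilb d →L[ℂ] Hilb d) : ℝ≥0∞ :=
  transportE (1 / 2) ħ p R

end SemiclassicalTransport

end

/-! The proof glues couplings. Let `γ` couple `f` and `g`, and let `Q` couple `g` and `R`.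
Disintegrate `γ` as `f(z) dz γ_z(dw)` and write `Q(w) = g(w) P(w)`, where `P(w)` is a state for
almost every `w` with respect to `g dw`. Then `Q'(z) = f(z) ∫ P(w) γ_z(dw)` couples `f` and `R`
(`isCoupling_gluedFamily`), and its cost is the `γ`-integral of the trace of `P(w)` against the
oscillator centred at `z`.

Moving the centre from `z` to `w` costs little: as quadratic forms, `C_z ≤ (1 + ε) C_w + (1 + 1/ε)
|z - w|²`, where `C_z` is the oscillator without the factor `κ` (`oscForm_le`). Since `trace P ≤ 1`,
integration over `γ` bounds the glued cost by `(1 + ε)` times the cost of `Q` plus `(1 + 1/ε)` times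
the cost of `γ`. Optimizing over `ε` turns this into the triangle inequality for square roots
(`rpow_half_le_of_forall_weighted`), and infima over `γ` and `Q` finish the proof. No optimal
coupling is needed.

The analytic point is that the trace against `C_z` is defined through the nonlinear square root of
the operator, yet must commute with averaging. It does because the form of `C_z` is a countable sum
of squares of bounded functionals (`exists_oscForm_eq_tsum`), so that the trace becomes a countable
sum of diagonal matrix elements. -/

open scoped ProbabilityTheory

namespace SemiclassicalTransport

/-! ### Square roots, traces and form traces of positive operators. -/

section Hilbert

variable {H : Type*} [NormedAddCommGroup H] [InnerProductSpace ℂ H]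

theorem tsum_enorm_inner_sq {ι : Type*} (b : HilbertBasis ι ℂ H) (x : H) :
    ∑' i, ‖⟪b i, x⟫_ℂ‖ₑ ^ 2 = ‖x‖ₑ ^ 2 := by
  have h := (Complex.hasSum_re (b.hasSum_inner_mul_inner x x))
  have e : ∀ i, (⟪x, b i⟫_ℂ * ⟪b i, x⟫_ℂ).re = ‖⟪b i, x⟫_ℂ‖ ^ 2 := fun i => by
    rw [← inner_conj_symm x (b i), ← Complex.normSq_eq_conj_mul_self, Complex.ofReal_re,
      Complex.normSq_eq_norm_sq]
  simp only [e] at h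
  have h2 : (⟪x, x⟫_ℂ).re = ‖x‖ ^ 2 := by
    simpa using inner_self_eq_norm_sq (𝕜 := ℂ) x
  rw [h2] at h
  have h3 := ENNReal.ofReal_tsum_of_nonneg (fun i => by positivity) h.summable
  rw [h.tsum_eq] at h3
  simpa [ENNReal.ofReal_pow, ofReal_norm] using h3.symm

theorem countable_of_hilbertBasis [TopologicalSpace.SeparableSpace H] {ι : Type*}
    (b : HilbertBasis ι ℂ H) : Countable ι := by
  refine Pairwise.countable_of_isOpen_disjoint (s := fun i => Metric.ball (b i) (1 / 2)) ?_
    (fun i => Metric.isOpen_ball) (fun i => ⟨b i, by simp⟩)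
  intro i j hij
  apply Metric.ball_disjoint_ball
  have h : ‖b i - b j‖ ^ 2 = 2 := by
    rw [@norm_sub_sq ℂ, b.orthonormal.2 hij, b.orthonormal.1 i, b.orthonormal.1 j]
    norm_num
  rw [dist_eq_norm]
  nlinarith [norm_nonneg (b i - b j)]

theorem isPositive_smul {c : ℝ} (hc : 0 ≤ c) {T : H →L[ℂ] H} (hT : T.IsPositive) :
    ((c : ℂ) • T).IsPositive :=
  hT.smul_of_nonneg (by exact_mod_cast hc)

variable [CompleteSpace H]

theorem opSqrt_isSelfAdjoint (T : H →L[ℂ] H) : IsSelfAdjoint (opSqrt T) :=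
  IsSelfAdjoint.of_nonneg (CFC.sqrt_nonneg T)

theorem inner_opSqrt_left (T : H →L[ℂ] H) (x y : H) :
    ⟪opSqrt T x, y⟫_ℂ = ⟪x, opSqrt T y⟫_ℂ :=
  (opSqrt_isSelfAdjoint T).isSymmetric x y

theorem opSqrt_opSqrt {T : H →L[ℂ] H} (hT : T.IsPositive) (x : H) :
    opSqrt T (opSqrt T x) = T x := by
  have h0 : 0 ≤ T := (ContinuousLinearMap.nonneg_iff_isPositive T).2 hT
  exact congrArg (fun S : H →L[ℂ] H => S x) (CFC.sqrt_mul_sqrt_self T h0)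

theorem enorm_opSqrt_sq {T : H →L[ℂ] H} (hT : T.IsPositive) (x : H) :
    ‖opSqrt T x‖ₑ ^ 2 = ENNReal.ofReal (RCLike.re ⟪x, T x⟫_ℂ) := by
  rw [← opSqrt_opSqrt hT, ← inner_opSqrt_left, inner_self_eq_norm_sq,
    ENNReal.ofReal_pow (norm_nonneg _), ofReal_norm]

/-- The trace of a form which is a sum of squares of bounded linear functionals is linear in the
operator. -/
theorem formTrace_eq_tsum {ι : Type*} {q : H → ℝ≥0∞} {v : ι → H}
    (hq : ∀ ψ, q ψ = ∑' j, ‖⟪v j, ψ⟫_ℂ‖ₑ ^ 2) {T : H →L[ℂ] H} (hT : T.IsPositive) :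
    formTrace q T = ∑' j, ENNReal.ofReal (RCLike.re ⟪v j, T (v j)⟫_ℂ) := by
  simp only [formTrace, hq]
  -- Exchanging the sums and moving the square root onto `v j` gives, by Parseval, `∑ j, ‖√T (v
  -- j)‖²`, which is linear in `T`.
  rw [ENNReal.tsum_comm]
  refine tsum_congr fun j => ?_
  rw [← enorm_opSqrt_sq hT, ← tsum_enorm_inner_sq (basis H)]
  refine tsum_congr fun i => ?_
  rw [← inner_opSqrt_left, ← inner_conj_symm, ← ofReal_norm, RCLike.norm_conj,
    ofReal_norm]

theorem trace_eq_tsum {T : H →L[ℂ] H} (hT : T.IsPositive) :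
    trace T = ∑' i, ‖opSqrt T (basis H i)‖ₑ ^ 2 := by
  simp only [trace, enorm_opSqrt_sq hT]

/-- The operator norm of `√T` is at most its Hilbert–Schmidt norm, whose square is `trace T`. -/
theorem enorm_opSqrt_sq_le {T : H →L[ℂ] H} (hT : T.IsPositive) (x : H) :
    ‖opSqrt T x‖ₑ ^ 2 ≤ trace T * ‖x‖ₑ ^ 2 := by
  rw [← tsum_enorm_inner_sq (basis H), trace_eq_tsum hT, ← ENNReal.tsum_mul_right]
  refine ENNReal.tsum_le_tsum fun i => ?_
  rw [← inner_opSqrt_left, ← mul_pow]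
  gcongr
  simpa only [← ofReal_norm, ← ENNReal.ofReal_mul (norm_nonneg _)] using
    ENNReal.ofReal_le_ofReal (norm_inner_le_norm _ _)

theorem eq_zero_of_trace_eq_zero {T : H →L[ℂ] H} (hT : T.IsPositive) (h : trace T = 0) :
    T = 0 := by
  ext x
  have := enorm_opSqrt_sq_le hT x
  rw [h, zero_mul, nonpos_iff_eq_zero, pow_eq_zero_iff two_ne_zero, enorm_eq_zero] at this
  rw [← opSqrt_opSqrt hT, this]
  simp

theorem norm_apply_le_of_trace_le_one {T : H →L[ℂ] H} (hT : T.IsPositive) (h : trace T ≤ 1)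
    (x : H) : ‖T x‖ ≤ ‖x‖ := by
  have key : ∀ y, ‖opSqrt T y‖ ≤ ‖y‖ := fun y => by
    have h1 : ‖opSqrt T y‖ₑ ^ 2 ≤ ‖y‖ₑ ^ 2 :=
      (enorm_opSqrt_sq_le hT y).trans (mul_le_of_le_one_left' h)
    have h2 := (ENNReal.pow_le_pow_left_iff two_ne_zero).1 h1
    rwa [enorm_le_iff_norm_le] at h2
  rw [← opSqrt_opSqrt hT]
  exact (key _).trans (key _)

theorem trace_smul {c : ℝ} (hc : 0 ≤ c) (T : H →L[ℂ] H) :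
    trace ((c : ℂ) • T) = ENNReal.ofReal c * trace T := by
  simp only [trace, ← ENNReal.tsum_mul_left, ← ENNReal.ofReal_mul hc]
  simp

theorem formTrace_smul {ι : Type*} {q : H → ℝ≥0∞} {v : ι → H}
    (hq : ∀ ψ, q ψ = ∑' j, ‖⟪v j, ψ⟫_ℂ‖ₑ ^ 2) {c : ℝ} (hc : 0 ≤ c) {T : H →L[ℂ] H}
    (hT : T.IsPositive) : formTrace q ((c : ℂ) • T) = ENNReal.ofReal c * formTrace q T := by
  rw [formTrace_eq_tsum hq hT, formTrace_eq_tsum hq (isPositive_smul hc hT)]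
  simp only [← ENNReal.tsum_mul_left, ← ENNReal.ofReal_mul hc]
  simp

end Hilbert

/-! ### Measurable families of operators and their weak integrals. -/

section WeakIntegral

variable {H : Type*} [NormedAddCommGroup H] [InnerProductSpace ℂ H] [CompleteSpace H]
  {X : Type*} [MeasurableSpace X]

/-- A weakly measurable family of nonnegative operators of trace at most one. -/
structure IsSubstateFamily (P : X → H →L[ℂ] H) : Prop where
  measurable : ∀ φ ψ, Measurable fun x => ⟪φ, P x ψ⟫_ℂ
  isPositive : ∀ x, (P x).IsPositive
  trace_le_one : ∀ x, trace (P x) ≤ 1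

theorem IsSubstateFamily.measurable_formTrace {P : X → H →L[ℂ] H} (hP : IsSubstateFamily P)
    {ι : Type*} [Countable ι] {q : H → ℝ≥0∞} {v : ι → H} (hq : ∀ ψ, q ψ = ∑' j, ‖⟪v j, ψ⟫_ℂ‖ₑ ^ 2) :
    Measurable fun x => formTrace q (P x) := by
  simp only [fun x => formTrace_eq_tsum hq (hP.isPositive x)]
  exact Measurable.tsum fun j =>
    (Complex.measurable_re.comp (hP.measurable (v j) (v j))).ennreal_ofReal

theorem IsSubstateFamily.norm_inner_le {P : X → H →L[ℂ] H} (hP : IsSubstateFamily P) (φ ψ : H)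
    (x : X) : ‖⟪φ, P x ψ⟫_ℂ‖ ≤ ‖φ‖ * ‖ψ‖ :=
  (norm_inner_le_norm _ _).trans (mul_le_mul_of_nonneg_left
    (norm_apply_le_of_trace_le_one (hP.isPositive x) (hP.trace_le_one x) ψ) (norm_nonneg _))

variable [TopologicalSpace.SeparableSpace H]

instance : Countable (basisIndex H) := countable_of_hilbertBasis (basis H)

/-- A weakly measurable vector-valued function in a separable Hilbert space is strongly
measurable. -/
theorem stronglyMeasurable_of_inner_basis {u : X → H}
    (hu : ∀ i, Measurable fun x => ⟪basis H i, u x⟫_ℂ) : StronglyMeasurable u := by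
  have hs : ∀ s : Finset (basisIndex H),
      StronglyMeasurable fun x => ∑ i ∈ s, ⟪basis H i, u x⟫_ℂ • basis H i := fun s =>
    Finset.stronglyMeasurable_fun_sum s fun i _ => (hu i).stronglyMeasurable.smul_const _
  refine stronglyMeasurable_of_tendsto Filter.atTop hs (tendsto_pi_nhds.2 fun x => ?_)
  have h := (basis H).hasSum_repr (u x)
  simpa only [HasSum, HilbertBasis.repr_apply_apply, SummationFilter.unconditional_filter] using h

/-- Reduces weak measurability to countably many matrix entries, so that almost-everywhere
representatives need to be corrected on only one null set. -/
theorem measurable_inner_apply {P : X → H →L[ℂ] H}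
    (hP : ∀ i j, Measurable fun x => ⟪basis H i, P x (basis H j)⟫_ℂ) (φ ψ : H) :
    Measurable fun x => ⟪φ, P x ψ⟫_ℂ := by
  have hj : ∀ j, StronglyMeasurable fun x => P x (basis H j) := fun j =>
    stronglyMeasurable_of_inner_basis fun i => hP i j
  have hs : ∀ s : Finset (basisIndex H), StronglyMeasurable fun x =>
      ∑ j ∈ s, ⟪basis H j, ψ⟫_ℂ • P x (basis H j) := fun s =>
    Finset.stronglyMeasurable_fun_sum s fun j _ => (hj j).const_smul _
  have : StronglyMeasurable fun x => P x ψ := by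
    refine stronglyMeasurable_of_tendsto Filter.atTop hs (tendsto_pi_nhds.2 fun x => ?_)
    have h := ((basis H).hasSum_repr ψ).mapL (P x)
    simpa only [HasSum, HilbertBasis.repr_apply_apply, map_smul,
      SummationFilter.unconditional_filter] using h
  exact (stronglyMeasurable_const.inner this).measurable

namespace IsSubstateFamily

variable {P : X → H →L[ℂ] H}

theorem stronglyMeasurable_apply (hP : IsSubstateFamily P) (ψ : H) :
    StronglyMeasurable fun x => P x ψ :=
  stronglyMeasurable_of_inner_basis fun _ => hP.measurable _ ψ

theorem integrable_apply (hP : IsSubstateFamily P) (ν : Measure X) [IsFiniteMeasure ν] (ψ : H) :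
    Integrable (fun x => P x ψ) ν :=
  .of_bound (hP.stronglyMeasurable_apply ψ).aestronglyMeasurable ‖ψ‖
    (.of_forall fun x => norm_apply_le_of_trace_le_one (hP.isPositive x) (hP.trace_le_one x) ψ)

end IsSubstateFamily

open Classical in
/-- The weak integral `∫ P dν` of a family of operators (zero if the family is not a measurable
family of nonnegative operators of trace at most one). -/
noncomputable def weakIntegral (P : X → H →L[ℂ] H) (ν : Measure X) [IsProbabilityMeasure ν] :
    H →L[ℂ] H :=
  if hP : IsSubstateFamily P then
    LinearMap.mkContinuous
      { toFun := fun ψ => ∫ x, P x ψ ∂ν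
        map_add' := fun φ ψ => by
          simp only [map_add]
          exact integral_add (hP.integrable_apply ν φ) (hP.integrable_apply ν ψ)
        map_smul' := fun c ψ => by
          simp only [map_smul, RingHom.id_apply]
          exact integral_smul c _ } 1
      fun ψ => by
        rw [one_mul]
        refine (norm_integral_le_of_norm_le_const (.of_forall fun x =>
          norm_apply_le_of_trace_le_one (hP.isPositive x) (hP.trace_le_one x) ψ)).trans ?_
        simp
  else 0

namespace IsSubstateFamily

variable {P : X → H →L[ℂ] H}

theorem weakIntegral_apply (hP : IsSubstateFamily P) (ν : Measure X) [IsProbabilityMeasure ν]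
    (ψ : H) : weakIntegral P ν ψ = ∫ x, P x ψ ∂ν := by
  simp [weakIntegral, hP]

theorem inner_weakIntegral (hP : IsSubstateFamily P) (ν : Measure X) [IsProbabilityMeasure ν]
    (φ ψ : H) : ⟪φ, weakIntegral P ν ψ⟫_ℂ = ∫ x, ⟪φ, P x ψ⟫_ℂ ∂ν := by
  rw [hP.weakIntegral_apply, integral_inner (hP.integrable_apply ν ψ)]

theorem re_inner_weakIntegral (hP : IsSubstateFamily P) (ν : Measure X) [IsProbabilityMeasure ν]
    (ψ : H) : RCLike.re ⟪ψ, weakIntegral P ν ψ⟫_ℂ = ∫ x, RCLike.re ⟪ψ, P x ψ⟫_ℂ ∂ν := by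
  rw [hP.inner_weakIntegral, integral_re ((hP.integrable_apply ν ψ).const_inner ψ)]

theorem ofReal_re_inner_weakIntegral (hP : IsSubstateFamily P) (ν : Measure X)
    [IsProbabilityMeasure ν] (ψ : H) :
    ENNReal.ofReal (RCLike.re ⟪ψ, weakIntegral P ν ψ⟫_ℂ) =
      ∫⁻ x, ENNReal.ofReal (RCLike.re ⟪ψ, P x ψ⟫_ℂ) ∂ν := by
  rw [hP.re_inner_weakIntegral, ofReal_integral_eq_lintegral_ofReal
    ((hP.integrable_apply ν ψ).const_inner ψ).re]
  exact .of_forall fun x => (hP.isPositive x).re_inner_nonneg_right ψ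

theorem isPositive_weakIntegral (hP : IsSubstateFamily P) (ν : Measure X)
    [IsProbabilityMeasure ν] : (weakIntegral P ν).IsPositive := by
  refine ⟨fun φ ψ => ?_, fun ψ => ?_⟩
  · change ⟪weakIntegral P ν φ, ψ⟫_ℂ = ⟪φ, weakIntegral P ν ψ⟫_ℂ
    rw [← inner_conj_symm, hP.inner_weakIntegral, hP.inner_weakIntegral, ← integral_conj]
    refine integral_congr_ae (.of_forall fun x => ?_)
    simp only [inner_conj_symm]
    exact (hP.isPositive x).1 φ ψ
  · change 0 ≤ RCLike.re ⟪weakIntegral P ν ψ, ψ⟫_ℂ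
    rw [inner_re_symm, hP.re_inner_weakIntegral]
    exact integral_nonneg fun x => (hP.isPositive x).re_inner_nonneg_right ψ

theorem trace_weakIntegral (hP : IsSubstateFamily P) (ν : Measure X) [IsProbabilityMeasure ν] :
    trace (weakIntegral P ν) = ∫⁻ x, trace (P x) ∂ν := by
  simp only [trace, hP.ofReal_re_inner_weakIntegral]
  exact (lintegral_tsum fun _ =>
    (Complex.measurable_re.comp (hP.measurable _ _)).ennreal_ofReal.aemeasurable).symm

/-- Once the form is a sum of squares, both sides are countable sums of diagonal matrix elements,
and Tonelli exchanges the sum with the integral. -/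
theorem formTrace_weakIntegral (hP : IsSubstateFamily P) (ν : Measure X) [IsProbabilityMeasure ν]
    {ι : Type*} [Countable ι] {q : H → ℝ≥0∞} {v : ι → H}
    (hq : ∀ ψ, q ψ = ∑' j, ‖⟪v j, ψ⟫_ℂ‖ₑ ^ 2) :
    formTrace q (weakIntegral P ν) = ∫⁻ x, formTrace q (P x) ∂ν := by
  simp only [fun x => formTrace_eq_tsum hq (hP.isPositive x),
    formTrace_eq_tsum hq (hP.isPositive_weakIntegral ν), hP.ofReal_re_inner_weakIntegral]
  exact (lintegral_tsum fun _ =>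
    (Complex.measurable_re.comp (hP.measurable _ _)).ennreal_ofReal.aemeasurable).symm

end IsSubstateFamily

end WeakIntegral

/-! ### The oscillator form as a countable sum of squares. -/

instance separableSpace_hilb (d : ℕ) : TopologicalSpace.SeparableSpace (Hilb d) := by
  have : Fact ((2 : ℝ≥0∞) ≠ ∞) := ⟨by simp⟩
  infer_instance

theorem enorm_toLp_two_sq {α : Type*} [MeasurableSpace α] {μ : Measure α} {f : α → ℂ}
    (hf : MemLp f 2 μ) : ‖hf.toLp f‖ₑ ^ 2 = ∫⁻ x, ‖f x‖ₑ ^ 2 ∂μ := by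
  rw [Lp.enorm_toLp, eLpNorm_eq_lintegral_rpow_enorm_toReal (by simp) (by simp),
    ← ENNReal.rpow_natCast, ← ENNReal.rpow_mul]
  simp

/-- A weighted square norm is a countable sum of squares of bounded linear functionals. -/
theorem exists_lintegral_mul_enorm_sq_eq_tsum {α ι : Type*} [MeasurableSpace α] {μ : Measure α}
    (b : HilbertBasis ι ℂ (Lp ℂ 2 μ)) {m : α → ℝ} (hm : Measurable m) (h0 : ∀ x, 0 ≤ m x) :
    ∃ v : ℕ × ι → Lp ℂ 2 μ, ∀ ψ : Lp ℂ 2 μ,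
      ∫⁻ x, ENNReal.ofReal (m x ^ 2) * ‖ψ x‖ₑ ^ 2 ∂μ = ∑' j, ‖⟪v j, ψ⟫_ℂ‖ₑ ^ 2 := by
  classical
  -- These slices partition the space and `m` is bounded on each, so multiplication by `m` splits
  -- into bounded symmetric operators with disjoint supports.
  let A : ℕ → Set α := fun n => {x | ⌊m x⌋₊ = n}
  have hA : ∀ n, MeasurableSet (A n) := fun n =>
    (Nat.measurable_floor.comp hm) (measurableSet_singleton n)
  let c : ℕ → α → ℝ := fun n => (A n).indicator m
  have hc : ∀ n, Measurable (c n) := fun n => hm.indicator (hA n)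
  have hcb : ∀ n x, ‖((c n x : ℝ) : ℂ)‖ ≤ n + 1 := fun n x => by
    by_cases hx : x ∈ A n
    · have hx' : ⌊m x⌋₊ = n := hx
      have := (Nat.lt_floor_add_one (m x)).le
      rw [hx'] at this
      simpa [c, hx, abs_of_nonneg (h0 x)] using this
    · simp only [c, hx, not_false_eq_true, Set.indicator_of_notMem, Complex.ofReal_zero, norm_zero]
      positivity
  have hL : ∀ n (ψ : Lp ℂ 2 μ), MemLp (fun x => (c n x : ℂ) * ψ x) 2 μ := fun n ψ =>
    (Lp.memLp ψ).of_le_mul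
      ((Complex.measurable_ofReal.comp (hc n)).aestronglyMeasurable.mul
        (Lp.aestronglyMeasurable ψ))
      (.of_forall fun x => by
        rw [norm_mul]
        exact mul_le_mul_of_nonneg_right (hcb n x) (norm_nonneg _))
  have hinner : ∀ n (φ ψ : Lp ℂ 2 μ), ⟪(hL n φ).toLp, ψ⟫_ℂ = ⟪φ, (hL n ψ).toLp⟫_ℂ := by
    intro n φ ψ
    rw [L2.inner_def, L2.inner_def]
    refine integral_congr_ae ?_
    filter_upwards [(hL n φ).coeFn_toLp, (hL n ψ).coeFn_toLp] with x h1 h2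
    rw [h1, h2]
    simp only [RCLike.inner_apply, map_mul, Complex.conj_ofReal]
    ring
  -- The vectors are `c n • b i`. By symmetry and Parseval, the sum over `i` is the square norm of
  -- `c n * ψ`; at each point only one `n` then contributes.
  refine ⟨fun j => (hL j.1 (b j.2)).toLp, fun ψ => ?_⟩
  rw [ENNReal.summable.tsum_prod' fun _ => ENNReal.summable]
  simp only [hinner, tsum_enorm_inner_sq, enorm_toLp_two_sq]
  rw [← lintegral_tsum fun n => (hL n ψ).1.enorm.pow_const 2]
  refine lintegral_congr fun x => ?_
  rw [tsum_eq_single ⌊m x⌋₊]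
  · have : x ∈ A ⌊m x⌋₊ := rfl
    simp only [c, Set.indicator_of_mem this, enorm_mul, mul_pow]
    rw [← ofReal_norm (m x : ℂ), ← ENNReal.ofReal_pow (norm_nonneg _)]
    simp
  · intro n hn
    have : x ∉ A n := fun h => hn (Eq.symm h)
    simp [c, Set.indicator_of_notMem this]

theorem exists_oscForm_eq_tsum {d : ℕ} (ħ : ℝ) (z : Phase d) :
    ∃ v : (ℕ × basisIndex (Hilb d)) ⊕ (ℕ × basisIndex (Hilb d)) → Hilb d,
      ∀ ψ, oscForm ħ z ψ = ∑' j, ‖⟪v j, ψ⟫_ℂ‖ₑ ^ 2 := by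
  obtain ⟨v, hv⟩ := exists_lintegral_mul_enorm_sq_eq_tsum (basis (Hilb d))
    (m := fun y => ‖z.1 - y‖) (by fun_prop) (fun _ => norm_nonneg _)
  obtain ⟨w, hw⟩ := exists_lintegral_mul_enorm_sq_eq_tsum (basis (Hilb d))
    (m := fun k => ‖z.2 - (2 * Real.pi * ħ) • k‖) (by fun_prop) (fun _ => norm_nonneg _)
  -- The momentum functionals are found on the Fourier side and pulled back by Plancherel.
  refine ⟨Sum.elim v fun j => 𝓕⁻ (w j), fun ψ => ?_⟩
  rw [ENNReal.summable.tsum_sum ENNReal.summable]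
  simp only [Sum.elim_inl, Sum.elim_inr, oscForm, hv, hw]
  congr 1
  refine tsum_congr fun j => ?_
  rw [← Lp.inner_fourier_eq (𝓕⁻ (w j)) ψ, FourierTransform.fourier_fourierInv_eq]

/-! ### Weighted triangle inequalities and dependence on the centre. -/

theorem norm_sub_sq_le_weighted {E : Type*} [SeminormedAddCommGroup E] {ε : ℝ} (hε : 0 < ε)
    (a b c : E) :
    ‖a - c‖ ^ 2 ≤ (1 + ε) * ‖b - c‖ ^ 2 + (1 + ε⁻¹) * ‖a - b‖ ^ 2 := by
  have h1 : ‖a - c‖ ≤ ‖a - b‖ + ‖b - c‖ := norm_sub_le_norm_sub_add_norm_sub a b c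
  have h2 : ‖a - c‖ ^ 2 ≤ (‖a - b‖ + ‖b - c‖) ^ 2 := by gcongr
  -- Young's inequality for the cross term `2 ‖a - b‖ ‖b - c‖`, by completing the square.
  have h3 : 0 ≤ ε⁻¹ * (‖a - b‖ - ε * ‖b - c‖) ^ 2 := by positivity
  have h4 : ε⁻¹ * (‖a - b‖ - ε * ‖b - c‖) ^ 2 =
      ε⁻¹ * ‖a - b‖ ^ 2 - 2 * ‖a - b‖ * ‖b - c‖ + ε * ‖b - c‖ ^ 2 := by
    field_simp
    ring
  nlinarith

theorem lintegral_norm_sub_sq_le {d : ℕ} {ε : ℝ} (hε : 0 < ε) (a b : Config d)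
    (m : Config d → Config d) (ψ : Hilb d) :
    ∫⁻ y, ENNReal.ofReal (‖a - m y‖ ^ 2) * ‖ψ y‖ₑ ^ 2 ≤
      ENNReal.ofReal (1 + ε) * (∫⁻ y, ENNReal.ofReal (‖b - m y‖ ^ 2) * ‖ψ y‖ₑ ^ 2) +
        ENNReal.ofReal (1 + ε⁻¹) * ENNReal.ofReal (‖a - b‖ ^ 2) * ‖ψ‖ₑ ^ 2 := by
  have hψ : ‖ψ‖ₑ ^ 2 = ∫⁻ y, ‖ψ y‖ₑ ^ 2 := by
    conv_lhs => rw [← Lp.toLp_coeFn ψ (Lp.memLp ψ)]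
    exact enorm_toLp_two_sq _
  have hmeas : AEMeasurable (fun y => ‖ψ y‖ₑ ^ 2) :=
    (Lp.aestronglyMeasurable ψ).enorm.pow_const 2
  rw [hψ, ← lintegral_const_mul' _ _ ENNReal.ofReal_ne_top,
    ← lintegral_const_mul' _ _ (ENNReal.mul_ne_top ENNReal.ofReal_ne_top ENNReal.ofReal_ne_top),
    ← lintegral_add_right' _ (hmeas.const_mul _)]
  refine lintegral_mono fun y => ?_
  rw [← mul_assoc, ← add_mul, ← ENNReal.ofReal_mul (by positivity),
    ← ENNReal.ofReal_mul (by positivity), ← ENNReal.ofReal_add (by positivity) (by positivity)]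
  gcongr
  exact norm_sub_sq_le_weighted hε a b (m y)

theorem oscForm_le {d : ℕ} (ħ : ℝ) {ε : ℝ} (hε : 0 < ε) (z w : Phase d) (ψ : Hilb d) :
    oscForm ħ z ψ ≤ ENNReal.ofReal (1 + ε) * oscForm ħ w ψ +
      ENNReal.ofReal (1 + ε⁻¹) * ENNReal.ofReal (sqDist z w) * ‖ψ‖ₑ ^ 2 := by
  have h1 := lintegral_norm_sub_sq_le hε z.1 w.1 id ψ
  have h2 := lintegral_norm_sub_sq_le hε z.2 w.2
    (fun k => (2 * Real.pi * ħ) • k) (𝓕 ψ)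
  have h3 : ‖(𝓕 ψ : Hilb d)‖ₑ = ‖ψ‖ₑ := by
    rw [← ofReal_norm, Lp.norm_fourier_eq, ofReal_norm]
  rw [h3] at h2
  refine (add_le_add h1 h2).trans_eq ?_
  rw [oscForm, sqDist, ENNReal.ofReal_add (by positivity : 0 ≤ ‖z.1 - w.1‖ ^ 2) (by positivity)]
  simp only [id]
  ring

theorem oscTrace_le {d : ℕ} (ħ : ℝ) {ε : ℝ} (hε : 0 < ε) (z w : Phase d)
    {T : Hilb d →L[ℂ] Hilb d} (hT : T.IsPositive) :
    oscTrace ħ z T ≤ ENNReal.ofReal (1 + ε) * oscTrace ħ w T +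
      ENNReal.ofReal (1 + ε⁻¹) * ENNReal.ofReal (sqDist z w) * trace T := by
  rw [trace_eq_tsum hT, oscTrace, oscTrace, formTrace, formTrace, ← ENNReal.tsum_mul_left,
    ← ENNReal.tsum_mul_left, ← ENNReal.tsum_add]
  exact ENNReal.tsum_le_tsum fun i => oscForm_le ħ hε z w _

theorem oscTrace_smul {d : ℕ} (ħ : ℝ) (z : Phase d) {c : ℝ} (hc : 0 ≤ c)
    {T : Hilb d →L[ℂ] Hilb d} (hT : T.IsPositive) :
    oscTrace ħ z ((c : ℂ) • T) = ENNReal.ofReal c * oscTrace ħ z T := by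
  obtain ⟨v, hv⟩ := exists_oscForm_eq_tsum ħ z
  exact formTrace_smul hv hc hT

/-- With `ε = √b / √a` the right-hand side equals `(√a + √b)²`. -/
theorem rpow_half_le_of_forall_weighted {x a b : ℝ≥0∞}
    (h : ∀ ε : ℝ, 0 < ε → x ≤ ENNReal.ofReal (1 + ε) * a + ENNReal.ofReal (1 + ε⁻¹) * b) :
    x ^ (1 / 2 : ℝ) ≤ a ^ (1 / 2 : ℝ) + b ^ (1 / 2 : ℝ) := by
  by_cases ha : a = ⊤
  · simp [ha]
  by_cases hb : b = ⊤
  · simp [hb]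
  have hsq : ∀ c : ℝ≥0∞, (c ^ (1 / 2 : ℝ)) ^ (2 : ℕ) = c := fun c => by
    rw [← ENNReal.rpow_natCast, ← ENNReal.rpow_mul]
    simp
  obtain ⟨α, hα⟩ : ∃ α : NNReal, (α : ℝ≥0∞) = a ^ (1 / 2 : ℝ) :=
    ⟨_, ENNReal.coe_toNNReal (ENNReal.rpow_ne_top_of_nonneg (by norm_num) ha)⟩
  obtain ⟨β, hβ⟩ : ∃ β : NNReal, (β : ℝ≥0∞) = b ^ (1 / 2 : ℝ) :=
    ⟨_, ENNReal.coe_toNNReal (ENNReal.rpow_ne_top_of_nonneg (by norm_num) hb)⟩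
  have ha' : a = ENNReal.ofReal ((α : ℝ) ^ 2) := by
    rw [← hsq a, ← hα, ENNReal.ofReal_pow (NNReal.coe_nonneg _), ENNReal.ofReal_coe_nnreal]
  have hb' : b = ENNReal.ofReal ((β : ℝ) ^ 2) := by
    rw [← hsq b, ← hβ, ENNReal.ofReal_pow (NNReal.coe_nonneg _), ENNReal.ofReal_coe_nnreal]
  rw [← hα, ← hβ]
  -- Each root is enlarged by `δ / 2`, which keeps the optimal ratio positive and finite even when
  -- `a` or `b` vanishes.
  refine ENNReal.le_of_forall_pos_le_add fun δ hδ _ => ?_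
  rw [← ENNReal.pow_le_pow_left_iff (two_ne_zero : (2 : ℕ) ≠ 0), hsq]
  have hδ' : (0 : ℝ) < δ / 2 := by positivity
  have hA : (0 : ℝ) < α + δ / 2 := by positivity
  have hB : (0 : ℝ) < β + δ / 2 := by positivity
  refine (h ((β + δ / 2) / (α + δ / 2)) (div_pos hB hA)).trans ?_
  rw [ha', hb', ← ENNReal.ofReal_mul (by positivity), ← ENNReal.ofReal_mul (by positivity),
    ← ENNReal.ofReal_add (by positivity) (by positivity), ← ENNReal.coe_add, ← ENNReal.coe_add,
    ← ENNReal.ofReal_coe_nnreal, ← ENNReal.ofReal_pow (NNReal.coe_nonneg _)]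
  refine ENNReal.ofReal_le_ofReal ?_
  have h1 : (α : ℝ) ^ 2 ≤ (α + δ / 2) ^ 2 := by gcongr; linarith
  have h2 : (β : ℝ) ^ 2 ≤ (β + δ / 2) ^ 2 := by gcongr; linarith
  calc _ ≤ (1 + ((β : ℝ) + δ / 2) / (α + δ / 2)) * ((α : ℝ) + δ / 2) ^ 2 +
        (1 + (((β : ℝ) + δ / 2) / (α + δ / 2))⁻¹) * ((β : ℝ) + δ / 2) ^ 2 := by gcongr
    _ = _ := by
      push_cast
      field_simp
      ring

theorem le_iInf_rpow_half_iff {ι : Type*} {p : ι → Prop} {x : ℝ≥0∞} {u : ∀ i, p i → ℝ≥0∞} :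
    x ≤ (⨅ (i) (h : p i), u i h) ^ (1 / 2 : ℝ) ↔ ∀ i h, x ≤ u i h ^ (1 / 2 : ℝ) := by
  simp only [one_div, ENNReal.le_rpow_inv_iff (two_pos : (0 : ℝ) < 2), le_iInf_iff]

theorem rpow_half_ofReal_sqDist_le {d : ℕ} (z w : Phase d) :
    ENNReal.ofReal (sqDist z w) ^ (1 / 2 : ℝ) ≤ 2 * edist z w := by
  have h1 : ‖z.1 - w.1‖ ≤ dist z w := by rw [← dist_eq_norm]; exact le_max_left _ _
  have h2 : ‖z.2 - w.2‖ ≤ dist z w := by rw [← dist_eq_norm]; exact le_max_right _ _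
  have h3 : sqDist z w ≤ (2 * dist z w) ^ 2 := by
    have := pow_le_pow_left₀ (norm_nonneg _) h1 2
    have := pow_le_pow_left₀ (norm_nonneg _) h2 2
    rw [sqDist]
    nlinarith
  calc ENNReal.ofReal (sqDist z w) ^ (1 / 2 : ℝ)
      ≤ ENNReal.ofReal ((2 * dist z w) ^ 2) ^ (1 / 2 : ℝ) := by gcongr
    _ = 2 * edist z w := by
      rw [ENNReal.ofReal_pow (by positivity), ← ENNReal.rpow_natCast, ← ENNReal.rpow_mul,
        ENNReal.ofReal_mul (by norm_num), edist_dist]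
      simp

/-- The square root of the trace is 2-Lipschitz in the centre, by the weighted inequality with
`trace T ≤ 1`; the 2 absorbs the passage from the sup metric to the Euclidean one. Squaring
preserves continuity in `[0, ∞]`. -/
theorem continuous_oscTrace {d : ℕ} (ħ : ℝ) {T : Hilb d →L[ℂ] Hilb d} (hT : T.IsPositive)
    (h1 : trace T ≤ 1) : Continuous fun z => oscTrace ħ z T := by
  have hc : Continuous fun z => oscTrace ħ z T ^ (1 / 2 : ℝ) := by
    refine continuous_of_le_add_edist 2 (by simp) fun z w => ?_
    refine le_trans ?_ (add_le_add_right (rpow_half_ofReal_sqDist_le z w) _)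
    refine rpow_half_le_of_forall_weighted fun ε hε => (oscTrace_le ħ hε z w hT).trans ?_
    rw [mul_assoc]
    gcongr
    exact mul_le_of_le_one_right' h1
  have hsq : (fun z => oscTrace ħ z T) = fun z => (oscTrace ħ z T ^ (1 / 2 : ℝ)) ^ (2 : ℝ) := by
    funext z
    rw [← ENNReal.rpow_mul]
    simp
  rw [hsq]
  exact ENNReal.continuous_rpow_const.comp hc

/-- A Carathéodory function, continuous in the centre and measurable in the parameter, is jointly
measurable. Tonelli on `γ` relies on this. -/
theorem IsSubstateFamily.measurable_oscTrace {d : ℕ} {X : Type*} [MeasurableSpace X] (ħ : ℝ)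
    {P : X → Hilb d →L[ℂ] Hilb d} (hP : IsSubstateFamily P) :
    Measurable fun p : Phase d × X => oscTrace ħ p.1 (P p.2) :=
  measurable_uncurry_of_continuous_of_measurable (u := fun z w => oscTrace ħ z (P w))
    (fun w => continuous_oscTrace ħ (hP.isPositive w) (hP.trace_le_one w)) fun z => by
      obtain ⟨v, hv⟩ := exists_oscForm_eq_tsum ħ z
      exact hP.measurable_formTrace hv

theorem IsSubstateFamily.oscTrace_weakIntegral {d : ℕ} {X : Type*} [MeasurableSpace X] (ħ : ℝ)
    (z : Phase d) {P : X → Hilb d →L[ℂ] Hilb d} (hP : IsSubstateFamily P) (ν : Measure X)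
    [IsProbabilityMeasure ν] :
    oscTrace ħ z (weakIntegral P ν) = ∫⁻ x, oscTrace ħ z (P x) ∂ν := by
  obtain ⟨v, hv⟩ := exists_oscForm_eq_tsum ħ z
  exact hP.formTrace_weakIntegral ν hv

/-! ### Probability densities and factorization of couplings into states. -/

variable {d : ℕ}

theorem IsProbDensity.exists_measurable {f : Phase d → ℝ} (hf : IsProbDensity f) :
    ∃ F : Phase d → ℝ, Measurable F ∧ (∀ z, 0 ≤ F z) ∧ f =ᵐ[volume] F := by
  have hm := hf.integrable.aestronglyMeasurable.aemeasurable
  refine ⟨fun z => max (hm.mk f z) 0, hm.measurable_mk.max measurable_const,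
    fun z => le_max_right _ _, ?_⟩
  filter_upwards [hm.ae_eq_mk, hf.nonneg] with z h1 h2
  rw [← h1]
  exact (max_eq_left h2).symm

theorem densityMeasure_congr {f F : Phase d → ℝ} (h : f =ᵐ[volume] F) :
    densityMeasure f = densityMeasure F :=
  withDensity_congr_ae (h.fun_comp ENNReal.ofReal)

theorem IsProbDensity.isProbabilityMeasure {f : Phase d → ℝ} (hf : IsProbDensity f) :
    IsProbabilityMeasure (densityMeasure f) := by
  refine ⟨?_⟩
  rw [densityMeasure, withDensity_apply _ .univ, setLIntegral_univ,
    ← ofReal_integral_eq_lintegral_ofReal hf.integrable hf.nonneg, hf.integral_eq_one,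
    ENNReal.ofReal_one]

/-- A coupling factors as the product of its density and of a measurable family of states. -/
theorem IsCoupling.exists_factorization {g : Phase d → ℝ} (hg : IsProbDensity g)
    {R : Hilb d →L[ℂ] Hilb d} {Q : Phase d → Hilb d →L[ℂ] Hilb d} (hQ : IsCoupling g R Q) :
    ∃ (G : Phase d → ℝ) (P : Phase d → Hilb d →L[ℂ] Hilb d),
      Measurable G ∧ (∀ w, 0 ≤ G w) ∧ g =ᵐ[volume] G ∧ IsSubstateFamily P ∧
      (∀ᵐ w, Q w = (G w : ℂ) • P w) ∧ ∀ᵐ w ∂densityMeasure G, trace (P w) = 1 := by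
  classical
  obtain ⟨G, hGm, hG0, hgG⟩ := hg.exists_measurable
  let M := fun i j => hQ.aemeasurable (basis (Hilb d) i) (basis (Hilb d) j)
  have hgood : ∀ᵐ w : Phase d, (Q w).IsPositive ∧ trace (Q w) = ENNReal.ofReal (G w) ∧
      ∀ i j, ⟪basis (Hilb d) i, Q w (basis (Hilb d) j)⟫_ℂ = (M i j).mk _ w := by
    have hM : ∀ᵐ w : Phase d, ∀ i j,
        ⟪basis (Hilb d) i, Q w (basis (Hilb d) j)⟫_ℂ = (M i j).mk _ w :=
      ae_all_iff.2 fun i => ae_all_iff.2 fun j => (M i j).ae_eq_mk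
    filter_upwards [hQ.isPositive, hQ.trace_eq, hgG, hM] with w h1 h2 h3 h4
    exact ⟨h1, by rw [h2, h3], h4⟩
  obtain ⟨S, hSae, hSm, hS⟩ := hgood.exists_measurable_mem
  -- `P` vanishes off the good set `S` and, since `0⁻¹ = 0`, also where `G = 0`. Hence its trace is
  -- at most one everywhere but equals one only almost everywhere for `G dw`.
  let P : Phase d → Hilb d →L[ℂ] Hilb d := S.indicator fun w => (((G w)⁻¹ : ℝ) : ℂ) • Q w
  have hPpos : ∀ w, (P w).IsPositive := fun w => by
    by_cases hw : w ∈ S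
    · simpa only [P, Set.indicator_of_mem hw] using
        isPositive_smul (inv_nonneg.2 (hG0 w)) (hS w hw).1
    · simp only [P, Set.indicator_of_notMem hw]
      exact ContinuousLinearMap.isPositive_zero
  have hPtr : ∀ w ∈ S, trace (P w) = ENNReal.ofReal ((G w)⁻¹ * G w) := fun w hw => by
    simp only [P, Set.indicator_of_mem hw]
    rw [trace_smul (inv_nonneg.2 (hG0 w)), (hS w hw).2.1,
      ← ENNReal.ofReal_mul (inv_nonneg.2 (hG0 w))]
  refine ⟨G, P, hGm, hG0, hgG, ⟨?_, hPpos, fun w => ?_⟩, ?_, ?_⟩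
  · refine measurable_inner_apply fun i j => ?_
    have : (fun w => ⟪basis (Hilb d) i, P w (basis (Hilb d) j)⟫_ℂ) =
        S.indicator fun w => (((G w)⁻¹ : ℝ) : ℂ) * (M i j).mk _ w := by
      funext w
      by_cases hw : w ∈ S
      · simp only [P, Set.indicator_of_mem hw, ← (hS w hw).2.2 i j]
        simp only [smul_apply, inner_smul_right]
      · simp [P, Set.indicator_of_notMem hw]
    rw [this]
    exact ((Complex.measurable_ofReal.comp hGm.inv).mul (M i j).measurable_mk).indicator hSm
  · by_cases hw : w ∈ S
    · rw [hPtr w hw, ← ENNReal.ofReal_one]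
      exact ENNReal.ofReal_le_ofReal inv_mul_le_one
    · simp [P, Set.indicator_of_notMem hw, trace]
  · filter_upwards [hSae] with w hw
    -- Where `G` vanishes, `Q w` has zero trace and is therefore zero, so the factorization
    -- survives.
    by_cases h0 : G w = 0
    · rw [eq_zero_of_trace_eq_zero (hS w hw).1 (by rw [(hS w hw).2.1, h0, ENNReal.ofReal_zero]),
        h0, Complex.ofReal_zero, zero_smul]
    · simp only [P, Set.indicator_of_mem hw, smul_smul]
      rw [← Complex.ofReal_mul, mul_inv_cancel₀ h0, Complex.ofReal_one, one_smul]
  · rw [densityMeasure, ae_withDensity_iff hGm.ennreal_ofReal]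
    filter_upwards [hSae] with w hw h0
    have h0' : G w ≠ 0 := fun h => h0 (by simp [h])
    rw [hPtr w hw, inv_mul_cancel₀ h0', ENNReal.ofReal_one]

theorem integrable_densityMeasure_iff {E : Type*} [NormedAddCommGroup E] [NormedSpace ℝ E]
    {F : Phase d → ℝ} (hF : Measurable F) (h0 : ∀ z, 0 ≤ F z) (u : Phase d → E) :
    Integrable u (densityMeasure F) ↔ Integrable (fun z => F z • u z) := by
  rw [densityMeasure, integrable_withDensity_iff_integrable_smul' hF.ennreal_ofReal (by simp)]
  simp only [ENNReal.toReal_ofReal (h0 _)]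

theorem integral_densityMeasure {E : Type*} [NormedAddCommGroup E] [NormedSpace ℝ E]
    {F : Phase d → ℝ} (hF : Measurable F) (h0 : ∀ z, 0 ≤ F z) (u : Phase d → E) :
    ∫ z, u z ∂densityMeasure F = ∫ z, F z • u z := by
  rw [densityMeasure, integral_withDensity_eq_integral_toReal_smul hF.ennreal_ofReal (by simp)]
  simp only [ENNReal.toReal_ofReal (h0 _)]

theorem lintegral_densityMeasure {F : Phase d → ℝ} (hF : Measurable F) (u : Phase d → ℝ≥0∞) :
    ∫⁻ z, u z ∂densityMeasure F = ∫⁻ z, ENNReal.ofReal (F z) * u z := by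
  rw [densityMeasure, lintegral_withDensity_eq_lintegral_mul_non_measurable _ hF.ennreal_ofReal
    (by simp)]
  rfl

/-- The family of states `P`, distributed according to the second marginal of `γ`, averaged over
the conditional law of the second variable, with density `F` in the first one. -/
noncomputable def gluedFamily (F : Phase d → ℝ) (P : Phase d → Hilb d →L[ℂ] Hilb d)
    (γ : Measure (Phase d × Phase d)) [IsFiniteMeasure γ] (z : Phase d) : Hilb d →L[ℂ] Hilb d :=
  (F z : ℂ) • weakIntegral P (γ.condKernel z)

theorem IsSubstateFamily.measurable_oscTrace_self (ħ : ℝ) {P : Phase d → Hilb d →L[ℂ] Hilb d}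
    (hP : IsSubstateFamily P) : Measurable fun w => oscTrace ħ w (P w) := by
  have hd : Measurable fun w : Phase d => (w, w) := by fun_prop
  exact Measurable.comp (g := fun p : Phase d × Phase d => oscTrace ħ p.1 (P p.2))
    (f := fun w : Phase d => (w, w)) (hP.measurable_oscTrace ħ) hd

theorem lintegral_oscTrace_smul (ħ : ℝ) {G : Phase d → ℝ}
    {P : Phase d → Hilb d →L[ℂ] Hilb d} {γ : Measure (Phase d × Phase d)}
    (hP : IsSubstateFamily P) (hG : Measurable G)
    (hG0 : ∀ w, 0 ≤ G w) (h2 : γ.map Prod.snd = densityMeasure G) :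
    ∫⁻ w, oscTrace ħ w ((G w : ℂ) • P w) = ∫⁻ p, oscTrace ħ p.2 (P p.2) ∂γ := by
  have hw : ∀ w, oscTrace ħ w ((G w : ℂ) • P w) = ENNReal.ofReal (G w) * oscTrace ħ w (P w) :=
    fun w => oscTrace_smul ħ w (hG0 w) (hP.isPositive w)
  rw [lintegral_congr hw, ← lintegral_densityMeasure hG, ← h2,
    lintegral_map (hP.measurable_oscTrace_self ħ) measurable_snd]

/-! ### Gluing a classical coupling with a quantum one. -/

section Gluing

variable {F G : Phase d → ℝ} {P : Phase d → Hilb d →L[ℂ] Hilb d}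
  {γ : Measure (Phase d × Phase d)} [IsFiniteMeasure γ]

theorem inner_gluedFamily (hP : IsSubstateFamily P) (φ ψ : Hilb d) (z : Phase d) :
    ⟪φ, gluedFamily F P γ z ψ⟫_ℂ = F z • ∫ w, ⟪φ, P w ψ⟫_ℂ ∂γ.condKernel z := by
  rw [gluedFamily, smul_apply, inner_smul_right, hP.inner_weakIntegral,
    Complex.real_smul]

theorem isPositive_gluedFamily (hP : IsSubstateFamily P) (h0 : ∀ z, 0 ≤ F z) (z : Phase d) :
    (gluedFamily F P γ z).IsPositive :=
  isPositive_smul (h0 z) (hP.isPositive_weakIntegral _)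

theorem measurable_inner_gluedFamily (hP : IsSubstateFamily P) (hF : Measurable F)
    (φ ψ : Hilb d) : Measurable fun z => ⟪φ, gluedFamily F P γ z ψ⟫_ℂ := by
  simp only [inner_gluedFamily hP]
  have h : StronglyMeasurable fun p : Phase d × Phase d => ⟪φ, P p.2 ψ⟫_ℂ :=
    ((hP.measurable φ ψ).comp measurable_snd).stronglyMeasurable
  exact hF.smul h.integral_kernel_prod_right'.measurable

theorem integrable_inner_snd (hP : IsSubstateFamily P) (φ ψ : Hilb d) :
    Integrable (fun p : Phase d × Phase d => ⟪φ, P p.2 ψ⟫_ℂ) γ :=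
  .of_bound ((hP.measurable φ ψ).comp measurable_snd).aestronglyMeasurable (‖φ‖ * ‖ψ‖)
    (.of_forall fun p => hP.norm_inner_le φ ψ p.2)

theorem compProd_condKernel_eq (h1 : γ.map Prod.fst = densityMeasure F) :
    densityMeasure F ⊗ₘ γ.condKernel = γ := by
  rw [← h1]
  exact γ.disintegrate γ.condKernel

theorem integrable_inner_gluedFamily (hP : IsSubstateFamily P) (hF : Measurable F)
    (h0 : ∀ z, 0 ≤ F z) (h1 : γ.map Prod.fst = densityMeasure F) (φ ψ : Hilb d) :
    Integrable fun z => ⟪φ, gluedFamily F P γ z ψ⟫_ℂ := by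
  have : IsFiniteMeasure (densityMeasure F) := h1 ▸ inferInstance
  simp only [inner_gluedFamily hP]
  rw [← integrable_densityMeasure_iff hF h0]
  have hm : StronglyMeasurable fun p : Phase d × Phase d => ⟪φ, P p.2 ψ⟫_ℂ :=
    ((hP.measurable φ ψ).comp measurable_snd).stronglyMeasurable
  refine .of_bound hm.integral_kernel_prod_right'.aestronglyMeasurable (‖φ‖ * ‖ψ‖)
    (.of_forall fun z => ?_)
  simpa using norm_integral_le_of_norm_le_const (μ := γ.condKernel z)
    (.of_forall fun w => hP.norm_inner_le φ ψ w)

/-- Fubini on the disintegrated `γ` gives the integral of a function of the second variable alone,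
which sees only the second marginal. -/
theorem integral_inner_gluedFamily (hP : IsSubstateFamily P) (hF : Measurable F)
    (h0 : ∀ z, 0 ≤ F z) (hG : Measurable G) (hG0 : ∀ w, 0 ≤ G w)
    (h1 : γ.map Prod.fst = densityMeasure F) (h2 : γ.map Prod.snd = densityMeasure G)
    (φ ψ : Hilb d) :
    ∫ z, ⟪φ, gluedFamily F P γ z ψ⟫_ℂ = ∫ w, ⟪φ, ((G w : ℂ) • P w) ψ⟫_ℂ := by
  have : IsFiniteMeasure (densityMeasure F) := h1 ▸ inferInstance
  have hI := integrable_inner_snd (γ := γ) hP φ ψ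
  simp only [inner_gluedFamily hP]
  rw [← integral_densityMeasure hF h0, ← Measure.integral_compProd
    (f := fun p : Phase d × Phase d => ⟪φ, P p.2 ψ⟫_ℂ)
    (by rwa [compProd_condKernel_eq h1]), compProd_condKernel_eq h1]
  rw [← integral_map (f := fun w => ⟪φ, P w ψ⟫_ℂ) measurable_snd.aemeasurable
    (hP.measurable φ ψ).aestronglyMeasurable, h2, integral_densityMeasure hG hG0]
  simp only [smul_apply, inner_smul_right, Complex.real_smul]

theorem trace_gluedFamily (hP : IsSubstateFamily P) (hF : Measurable F)
    (h0 : ∀ z, 0 ≤ F z) (h1 : γ.map Prod.fst = densityMeasure F)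
    (h2 : γ.map Prod.snd = densityMeasure G)
    (htr : ∀ᵐ w ∂densityMeasure G, trace (P w) = 1) :
    ∀ᵐ z, trace (gluedFamily F P γ z) = ENNReal.ofReal (F z) := by
  have : IsFiniteMeasure (densityMeasure F) := h1 ▸ inferInstance
  have hγ : ∀ᵐ p ∂(densityMeasure F ⊗ₘ γ.condKernel), trace (P p.2) = 1 := by
    rw [compProd_condKernel_eq h1]
    rw [← h2] at htr
    exact ae_of_ae_map measurable_snd.aemeasurable htr
  have h := Measure.ae_ae_of_ae_compProd hγ
  rw [densityMeasure, ae_withDensity_iff hF.ennreal_ofReal] at h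
  filter_upwards [h] with z hz
  rw [gluedFamily, trace_smul (h0 z), hP.trace_weakIntegral]
  -- The conditional law is controlled only where `F` is nonzero; elsewhere both sides vanish.
  by_cases hz0 : ENNReal.ofReal (F z) = 0
  · simp [hz0]
  · rw [lintegral_congr_ae (hz hz0)]
    simp

theorem isCoupling_gluedFamily {R : Hilb d →L[ℂ] Hilb d} {f : Phase d → ℝ}
    {Q : Phase d → Hilb d →L[ℂ] Hilb d} {g : Phase d → ℝ} (hQ : IsCoupling g R Q)
    (hP : IsSubstateFamily P) (hF : Measurable F)
    (h0 : ∀ z, 0 ≤ F z) (hfF : f =ᵐ[volume] F) (hG : Measurable G) (hG0 : ∀ w, 0 ≤ G w)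
    (h1 : γ.map Prod.fst = densityMeasure F) (h2 : γ.map Prod.snd = densityMeasure G)
    (hQP : ∀ᵐ w, Q w = (G w : ℂ) • P w) (htr : ∀ᵐ w ∂densityMeasure G, trace (P w) = 1) :
    IsCoupling f R (gluedFamily F P γ) where
  aemeasurable φ ψ := (measurable_inner_gluedFamily hP hF φ ψ).aemeasurable
  isPositive := .of_forall fun z => isPositive_gluedFamily hP h0 z
  trace_eq := by
    filter_upwards [trace_gluedFamily hP hF h0 h1 h2 htr, hfF] with z hz hz'
    rw [hz, hz']
  integral_eq φ ψ := by
    refine ⟨integrable_inner_gluedFamily hP hF h0 h1 φ ψ, ?_⟩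
    rw [integral_inner_gluedFamily hP hF h0 hG hG0 h1 h2, ← (hQ.integral_eq φ ψ).2]
    refine integral_congr_ae ?_
    filter_upwards [hQP] with w hw
    rw [hw]

theorem lintegral_oscTrace_gluedFamily (ħ : ℝ) (hP : IsSubstateFamily P) (hF : Measurable F)
    (h0 : ∀ z, 0 ≤ F z) (h1 : γ.map Prod.fst = densityMeasure F) :
    ∫⁻ z, oscTrace ħ z (gluedFamily F P γ z) = ∫⁻ p, oscTrace ħ p.1 (P p.2) ∂γ := by
  have : IsFiniteMeasure (densityMeasure F) := h1 ▸ inferInstance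
  have hz : ∀ z, oscTrace ħ z (gluedFamily F P γ z) =
      ENNReal.ofReal (F z) * ∫⁻ w, oscTrace ħ z (P w) ∂γ.condKernel z := fun z => by
    rw [gluedFamily, oscTrace_smul ħ _ (h0 _) (hP.isPositive_weakIntegral _),
      hP.oscTrace_weakIntegral]
  rw [lintegral_congr hz, ← lintegral_densityMeasure hF,
    ← Measure.lintegral_compProd (hP.measurable_oscTrace ħ), compProd_condKernel_eq h1]

theorem lintegral_oscTrace_gluedFamily_le (ħ : ℝ) {ε : ℝ} (hε : 0 < ε)
    (hP : IsSubstateFamily P) (hF : Measurable F)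
    (h0 : ∀ z, 0 ≤ F z) (hG : Measurable G) (hG0 : ∀ w, 0 ≤ G w)
    (h1 : γ.map Prod.fst = densityMeasure F) (h2 : γ.map Prod.snd = densityMeasure G) :
    ∫⁻ z, oscTrace ħ z (gluedFamily F P γ z) ≤
      ENNReal.ofReal (1 + ε) * (∫⁻ w, oscTrace ħ w ((G w : ℂ) • P w)) +
        ENNReal.ofReal (1 + ε⁻¹) * ∫⁻ p, ENNReal.ofReal (sqDist p.1 p.2) ∂γ := by
  have hdiag : Measurable fun p : Phase d × Phase d => oscTrace ħ p.2 (P p.2) :=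
    (hP.measurable_oscTrace_self ħ).comp measurable_snd
  rw [lintegral_oscTrace_gluedFamily ħ hP hF h0 h1, lintegral_oscTrace_smul ħ hP hG hG0 h2,
    ← lintegral_const_mul' _ _ ENNReal.ofReal_ne_top,
    ← lintegral_const_mul' _ _ ENNReal.ofReal_ne_top,
    ← lintegral_add_left (hdiag.const_mul _)]
  refine lintegral_mono fun p => (oscTrace_le ħ hε p.1 p.2 (hP.isPositive p.2)).trans ?_
  rw [mul_assoc]
  exact add_le_add_right
    (mul_le_mul_right (mul_le_of_le_one_right' (hP.trace_le_one p.2)) _) _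

end Gluing

/-- The gluing estimate puts the factor `κ` on the classical cost too; `κ ≤ 1` lets it be dropped
there, which covers both normalizations. -/
theorem transportE_le_add {κ : ℝ≥0∞} (hκ : κ ≤ 1) (ħ : ℝ) {f g : Phase d → ℝ}
    (hf : IsProbDensity f) (hg : IsProbDensity g) (R : Hilb d →L[ℂ] Hilb d) :
    transportE κ ħ f R ≤
      distMK2 (densityMeasure f) (densityMeasure g) + transportE κ ħ g R := by
  have hκt : κ ≠ ⊤ := (hκ.trans_lt ENNReal.one_lt_top).ne
  have key : ∀ (γ : Measure (Phase d × Phase d)),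
      IsClassicalCoupling (densityMeasure f) (densityMeasure g) γ →
      ∀ Q, IsCoupling g R Q → transportE κ ħ f R ≤
        (∫⁻ p, ENNReal.ofReal (sqDist p.1 p.2) ∂γ) ^ (1 / 2 : ℝ) +
          (∫⁻ z, κ * oscTrace ħ z (Q z)) ^ (1 / 2 : ℝ) := by
    intro γ hγ Q hQ
    obtain ⟨F, hF, h0, hfF⟩ := hf.exists_measurable
    obtain ⟨G, P, hG, hG0, hgG, hP, hQP, htr⟩ := hQ.exists_factorization hg
    have h1 := hγ.1.trans (densityMeasure_congr hfF)
    have h2 := hγ.2.trans (densityMeasure_congr hgG)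
    have : IsProbabilityMeasure (densityMeasure f) := hf.isProbabilityMeasure
    have : IsProbabilityMeasure (γ.map Prod.fst) := hγ.1 ▸ this
    have : IsProbabilityMeasure γ := Measure.isProbabilityMeasure_of_map Prod.fst
    have hc := isCoupling_gluedFamily hQ hP hF h0 hfF hG hG0 h1 h2 hQP htr
    rw [add_comm]
    refine rpow_half_le_of_forall_weighted fun ε hε => (iInf₂_le _ hc).trans ?_
    rw [lintegral_const_mul' _ _ hκt, lintegral_const_mul' _ _ hκt]
    have hQ' : ∫⁻ z, oscTrace ħ z (Q z) = ∫⁻ w, oscTrace ħ w ((G w : ℂ) • P w) := by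
      refine lintegral_congr_ae ?_
      filter_upwards [hQP] with w hw
      rw [hw]
    rw [hQ']
    refine (mul_le_mul_right
      (lintegral_oscTrace_gluedFamily_le ħ hε hP hF h0 hG hG0 h1 h2) κ).trans ?_
    rw [mul_add, mul_left_comm]
    exact add_le_add_right (mul_le_of_le_one_left' hκ) _
  -- Truncated subtraction isolates each infimum in turn. Square root commutes with infima, so it
  -- suffices to treat individual `Q` and `γ`.
  rw [← tsub_le_iff_left]
  refine le_iInf_rpow_half_iff.2 fun Q hQ => ?_
  rw [tsub_le_iff_left, ← tsub_le_iff_right]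
  refine le_iInf_rpow_half_iff.2 fun γ hγ => ?_
  rw [tsub_le_iff_right]
  exact key γ hγ Q hQ

end SemiclassicalTransport

theorem theorem3p4 {d : ℕ} (ħ : ℝ) (hħ : 0 < ħ)
    (f g : SemiclassicalTransport.Phase d → ℝ)
    (hf : SemiclassicalTransport.IsProbDensity f) (hg : SemiclassicalTransport.IsProbDensity g)
    (hfg : ∫⁻ z : SemiclassicalTransport.Phase d,
      ENNReal.ofReal ((‖z.1‖ ^ 2 + ‖z.2‖ ^ 2) * (f z + g z)) < ⊤)
    (R : SemiclassicalTransport.Hilb d →L[ℂ] SemiclassicalTransport.Hilb d)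
    (hR : SemiclassicalTransport.IsDensityOperator R)
    (hRfin : SemiclassicalTransport.oscTrace ħ 0 R < ⊤) :
    -- the inequality for `E_ħ`, whose cost is `½ (|x - y|² + |ξ + iħ∇_y|²)`
    SemiclassicalTransport.Ehbar ħ f R ≤
        SemiclassicalTransport.distMK2 (SemiclassicalTransport.densityMeasure f)
          (SemiclassicalTransport.densityMeasure g) + SemiclassicalTransport.Ehbar ħ g R ∧
      -- the inequality for the cost without the factor `½`
      SemiclassicalTransport.transportE 1 ħ f R ≤
        SemiclassicalTransport.distMK2 (SemiclassicalTransport.densityMeasure f)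
          (SemiclassicalTransport.densityMeasure g) +
          SemiclassicalTransport.transportE 1 ħ g R := by
  exact ⟨SemiclassicalTransport.transportE_le_add
    (ENNReal.div_le_of_le_mul (by norm_num)) ħ hf hg R,
    SemiclassicalTransport.transportE_le_add le_rfl ħ hf hg R⟩
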